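/- All graphs are finite, simple and undirected. Let $Q_n$ be the hypercube on $\{0,1\}^n$; a partial cube is a graph isomorphic to an isometric subgraph of some $Q_n$. Two edges $e=uv$ and $f=xy$ of a graph $G$ are in relation $\Theta$ if $d(u,x)+d(v,y)\neq d(u,y)+d(v,x)$; in a partial cube $\Theta$ is an equivalence relation on the edges, and $F_{uv}$ denotes the $\Theta$-class of the edge $uv$. Put $W_{uv}=\{w\in V(G): d(u,w)<d(v,w)\}$. The crossing graph $G^{\#}$ has the $\Theta$-classes as its vertices, two distinct classes $F_{ab}$, $F_{uv}$ being adjacent if $W_{ab}\cap W_{uv}$, $W_{ba}\cap W_{uv}$, $W_{ab}\cap W_{vu}$ and $W_{ba}\cap W_{vu}$ are all nonempty (for $G=K_1$ it is the graph without vertices). Let $C_G(x)=\sum_k c_k x^k$, where $c_k$ is the number of induced subgraphs of $G$ isomorphic to $Q_k$; let $W_{G,u}(x)=\sum_d w_d x^d$, where $w_d$ is the number of vertices at distance $d$ from $u$; and let $Cl_H(x)=\sum_i a_i x^i$ be the clique polynomial of a graph $H$, where $a_i$ is the number of cliques with $i$ vertices ($a_0=1$). The simplex graph $S(H)$ of a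 graph $H$ has the cliques of $H$, including $\emptyset$, as its vertices, two of them being adjacent if they differ in exactly one vertex. We say that $G$ is a simplex graph with $u=\emptyset$ if for some graph $H$ there is an isomorphism $G\to S(H)$ that maps $u$ to $\emptyset$. **Theorem.** Let $G$ be a partial cube. 1. For every $u\in V(G)$: $G$ is a simplex graph with $u=\emptyset$ if and only if $W_{G,u}(x)=Cl_{G^{\#}}(x)$. 2. For every $u\in V(G)$, $W_{G,u}(x+1)$ and $Cl_{G^{\#}}(x+1)$ are upper bounds on $C_G(x)$, coefficient by coefficient, and these two bounds coincide if and only if $G$ is a simplex graph with $u=\emptyset$. In particular, $G$ is a simplex graph if and only if $W_{G,u}(x+1)=Cl_{G^{\#}}(x+1)$ for some $u\in V(G)$. -/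

import Mathlib

namespace CubeGraph

/-- The `n`-cube `Q_n`: binary strings of length `n`, adjacent when they differ in exactly one
position. -/
def hypercube (n : ℕ) : SimpleGraph (Fin n → Bool) where
  Adj u v := hammingDist u v = 1
  symm := ⟨fun u v h => by rw [hammingDist_comm]; exact h⟩
  loopless := ⟨fun u h => by simp [hammingDist_self] at h⟩

/-- `G` is a partial cube: it is isomorphic to an isometric subgraph of some `Q_n`. A map that
preserves extended distances (`⊤` between different components) is injective and preserves and
reflects adjacency, so it is an isomorphism onto an isometric subgraph. -/
def IsPartialCube {V : Type*} (G : SimpleGraph V) : Prop :=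
  ∃ (n : ℕ) (f : V → Fin n → Bool), ∀ u v, (hypercube n).edist (f u) (f v) = G.edist u v

/-- The number of induced subgraphs of `G` that are isomorphic to `Q_k`. -/
noncomputable def cubeCount {V : Type*} (G : SimpleGraph V) (k : ℕ) : ℕ :=
  {S : Set V | Nonempty (G.induce S ≃g hypercube k)}.ncard

/-- The cube polynomial of a finite graph. As `k < 2 ^ k`, all later terms vanish. -/
noncomputable def cubePolynomial {V : Type*} (G : SimpleGraph V) : Polynomial ℕ :=
  ∑ k ∈ Finset.range (Nat.card V), Polynomial.monomial k (cubeCount G k)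

/-- The number of vertices of `G` at distance `d` from `u`. -/
noncomputable def distanceCount {V : Type*} (G : SimpleGraph V) (u : V) (d : ℕ) : ℕ :=
  {v : V | G.edist u v = d}.ncard

/-- The distance polynomial of a finite graph with respect to the vertex `u`. As finite distances
are smaller than the number of vertices, all later terms vanish. -/
noncomputable def distancePolynomial {V : Type*} (G : SimpleGraph V) (u : V) : Polynomial ℕ :=
  ∑ d ∈ Finset.range (Nat.card V), Polynomial.monomial d (distanceCount G u d)

/-- The number of `i`-cliques of `G`; the empty set is the only `0`-clique. -/
noncomputable def cliqueCount {V : Type*} (G : SimpleGraph V) (i : ℕ) : ℕ :=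
  {s : Finset V | G.IsNClique i s}.ncard

/-- The clique polynomial of a finite graph. -/
noncomputable def cliquePolynomial {V : Type*} (G : SimpleGraph V) : Polynomial ℕ :=
  ∑ i ∈ Finset.range (Nat.card V + 1), Polynomial.monomial i (cliqueCount G i)

/-- The Djoković–Winkler relation on the edges of `G`. The inequality does not depend on the order
in which the ends of either edge are listed. -/
def Theta {V : Type*} (G : SimpleGraph V) (e f : Sym2 V) : Prop :=
  ∃ u v x y : V, e = s(u, v) ∧ f = s(x, y) ∧ G.Adj u v ∧ G.Adj x y ∧
    G.dist u x + G.dist v y ≠ G.dist u y + G.dist v x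

/-- The class `F_{uv}` of all edges in relation `Theta` to the edge `uv`. -/
def thetaClass {V : Type*} (G : SimpleGraph V) (u v : V) : Set (Sym2 V) :=
  {f | Theta G f s(u, v)}

/-- The type of all classes `F_{uv}`, for `uv` an edge of `G`. -/
def ThetaClasses {V : Type*} (G : SimpleGraph V) : Type _ :=
  {F : Set (Sym2 V) // ∃ u v, G.Adj u v ∧ F = thetaClass G u v}

/-- The set `W_{uv}` of all vertices closer to `u` than to `v`. -/
def halfspace {V : Type*} (G : SimpleGraph V) (u v : V) : Set V :=
  {w | G.dist u w < G.dist v w}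

/-- Two classes `F_{ab}` and `F_{uv}` cross if the four intersections of their halfspaces are
nonempty. In a partial cube the choice of the edges `ab` and `uv` in the classes is immaterial. -/
def Cross {V : Type*} (G : SimpleGraph V) (F F' : ThetaClasses G) : Prop :=
  ∃ a b u v : V, G.Adj a b ∧ G.Adj u v ∧ F.1 = thetaClass G a b ∧ F'.1 = thetaClass G u v ∧
    (halfspace G a b ∩ halfspace G u v).Nonempty ∧
    (halfspace G b a ∩ halfspace G u v).Nonempty ∧
    (halfspace G a b ∩ halfspace G v u).Nonempty ∧
    (halfspace G b a ∩ halfspace G v u).Nonempty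

/-- The crossing graph of `G`: its vertices are the classes, adjacent when they cross. -/
def crossingGraph {V : Type*} (G : SimpleGraph V) : SimpleGraph (ThetaClasses G) where
  Adj F F' := F ≠ F' ∧ Cross G F F'
  symm := ⟨by
    rintro F F' ⟨hne, a, b, u, v, hab, huv, hF, hF', h1, h2, h3, h4⟩
    refine ⟨hne.symm, u, v, a, b, huv, hab, hF', hF, ?_, ?_, ?_, ?_⟩
    · rwa [Set.inter_comm]
    · rwa [Set.inter_comm]
    · rwa [Set.inter_comm]
    · rwa [Set.inter_comm]⟩
  loopless := ⟨fun _ h => h.1 rfl⟩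

/-- The simplex graph of `H`: its vertices are the cliques of `H`, including the empty one, and two
cliques are adjacent when they differ in exactly one vertex. -/
def simplexGraph {α : Type*} [DecidableEq α] (H : SimpleGraph α) :
    SimpleGraph {s : Finset α // H.IsClique (s : Set α)} where
  Adj s t := (symmDiff s.1 t.1).card = 1
  symm := ⟨fun s t h => by rw [symmDiff_comm]; exact h⟩
  loopless := ⟨fun s h => by simp at h⟩

/-- `G` is (isomorphic to) the simplex graph of a finite graph. -/
def IsSimplexGraph {V : Type*} (G : SimpleGraph V) : Prop :=
  ∃ (n : ℕ) (H : SimpleGraph (Fin n)), Nonempty (G ≃g simplexGraph H)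

/-- `G` is a simplex graph with `u = ∅`: some isomorphism from `G` to the simplex graph of a finite
graph sends `u` to the empty clique. -/
def IsSimplexGraphAt {V : Type*} (G : SimpleGraph V) (u : V) : Prop :=
  ∃ (n : ℕ) (H : SimpleGraph (Fin n)) (φ : G ≃g simplexGraph H), (φ u).1 = ∅

end CubeGraph

/-! An isometric embedding into a cube, translated so that `u` goes to `∅` and with constant
coordinates dropped, turns `G` into a family `F` of finite sets. Then `W_{G,u}` sums `x ^ #A` over
`A ∈ F`, the Θ-classes are the coordinates, and `Cl_{G#}` sums `x ^ #s` over the family `C` of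
cliques of the crossing graph on coordinates.

The link is shattering: a set shattered by `F` is a clique, as its traces put any two of its
coordinates in all four positions. Pajor's inequality (`card_le_card_shatterer`) then gives `#F ≤
#F.shatterer ≤ #C`. Induced cubes are intervals `[A, A ∪ K]` inside `F`. Counting them by top and
directions gives the bound by `W(x+1)`; counting the bottoms for fixed `K` by Pajor's inequality
gives the bound by `Cl(x+1)`.

If the two polynomials agree, their values and derivatives at `1` show that `F` and `C` have equal
cardinality and equal total size. So `F.shatterer = C`; down-compression shows that `F` is a lower
set or has larger total size than its shatterer (`shatterer_eq_or_sum_card_lt`). Hence `F = C`, and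
`G` is a simplex graph. -/

open Finset Polynomial
open scoped symmDiff FinsetFamily

/-! ### Symmetric differences of finite sets -/

namespace Finset

variable {ι : Type*} [DecidableEq ι]

theorem card_symmDiff_singleton_of_mem {A : Finset ι} {i : ι} (h : i ∈ A) :
    #(A ∆ {i}) + 1 = #A := by
  have : A ∆ {i} = A.erase i := by
    ext j; simp only [mem_symmDiff, mem_singleton, mem_erase]; grind
  rw [this, card_erase_add_one h]

theorem card_symmDiff_singleton_of_notMem {A : Finset ι} {i : ι} (h : i ∉ A) :
    #(A ∆ {i}) = #A + 1 := by
  have : A ∆ {i} = insert i A := by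
    ext j; simp only [mem_symmDiff, mem_singleton, mem_insert]; grind
  rw [this, card_insert_of_notMem h]

theorem card_symmDiff_triangle (A B C : Finset ι) : #(A ∆ C) ≤ #(A ∆ B) + #(B ∆ C) :=
  (card_le_card (symmDiff_triangle A B C)).trans (card_union_le _ _)

/-- Toggling distinct `i` and `j` changes the size by independent amounts, so the two sums agree;
toggling `i` twice restores `A`. This becomes the Θ relation in coordinates. -/
theorem card_add_card_symmDiff_ne_iff (A : Finset ι) (i j : ι) :
    #A + #(A ∆ {j} ∆ {i}) ≠ #(A ∆ {i}) + #(A ∆ {j}) ↔ j = i := by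
  rcases eq_or_ne j i with rfl | hij
  · simp only [symmDiff_assoc, symmDiff_self, symmDiff_bot, ne_eq, iff_true]
    by_cases h : j ∈ A
    · have := card_symmDiff_singleton_of_mem h; omega
    · have := card_symmDiff_singleton_of_notMem h; omega
  · simp only [hij, iff_false, not_not]
    have hmem : i ∈ A ∆ {j} ↔ i ∈ A := by
      simp [mem_symmDiff, hij.symm]
    by_cases hi : i ∈ A
    · have h1 := card_symmDiff_singleton_of_mem hi
      have h2 := card_symmDiff_singleton_of_mem (hmem.2 hi)
      omega
    · have h1 := card_symmDiff_singleton_of_notMem hi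
      have h2 := card_symmDiff_singleton_of_notMem (mt hmem.1 hi)
      omega

/-! ### Shattering and down-compression -/

/-- Down-compression moving at least one set strictly decreases the sum of the sizes. -/
theorem sum_card_compression_lt {F : Finset (Finset ι)} {a : ι} {s : Finset ι} (hs : s ∈ F)
    (hsa : s.erase a ∉ F) : ∑ t ∈ 𝓓 a F, #t < ∑ t ∈ F, #t := by
  have himg : 𝓓 a F = F.image fun t => if t.erase a ∈ F then t else t.erase a := by
    ext t
    rw [Down.mem_compression, mem_image]
    constructor
    · rintro (⟨h1, h2⟩ | ⟨h1, h2⟩)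
      · exact ⟨t, h1, if_pos h2⟩
      · have hat : a ∉ t := fun h => h1 (by rwa [insert_eq_of_mem h] at h2)
        exact ⟨insert a t, h2, by rw [erase_insert hat, if_neg h1]⟩
    · rintro ⟨r, hr, rfl⟩
      split_ifs with h
      · exact Or.inl ⟨hr, h⟩
      · have har : a ∈ r := by
          by_contra har
          exact h (by rwa [erase_eq_of_notMem har])
        exact Or.inr ⟨h, by rwa [insert_erase har]⟩
  -- Compression preserves cardinality, so the map is injective on `F` and the two sums can be
  -- compared term by term.
  have hinj : Set.InjOn (fun t => if t.erase a ∈ F then t else t.erase a) (F : Set (Finset ι)) := by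
    rw [← card_image_iff, ← himg, Down.card_compression]
  rw [himg, sum_image hinj]
  refine sum_lt_sum (fun t _ => ?_) ⟨s, hs, ?_⟩
  · split_ifs
    · exact le_rfl
    · exact card_le_card (erase_subset _ _)
  · rw [if_neg hsa]
    refine card_erase_lt_of_mem ?_
    by_contra h
    exact hsa (by rwa [erase_eq_of_notMem h])

/-- A family that shatters no more sets than it has members is either a lower set, or its members
are larger, in total, than the shattered sets. -/
theorem shatterer_eq_or_sum_card_lt (F : Finset (Finset ι)) (hF : #F.shatterer ≤ #F) :
    F.shatterer = F ∨ ∑ t ∈ F.shatterer, #t < ∑ t ∈ F, #t := by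
  induction hn : ∑ t ∈ F, #t using Nat.strong_induction_on generalizing F with
  | _ n ih =>
  subst hn
  by_cases hlow : ∀ s ∈ F, ∀ a, s.erase a ∈ F
  · left
    rw [shatterer_eq]
    intro s t hts hs
    have key : ∀ r : Finset ι, s \ r ∈ F := by
      intro r
      induction r using Finset.induction_on with
      | empty => simpa using hs
      | insert a r _ ih => rw [sdiff_insert]; exact hlow _ ih _
    have := key (s \ t)
    rwa [sdiff_sdiff_eq_self hts] at this
  · push Not at hlow
    obtain ⟨s, hs, a, hsa⟩ := hlow
    right
    have hlt := sum_card_compression_lt hs hsa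
    -- Compression keeps `#F` and cannot enlarge the shatterer; Pajor's inequality leaves no room
    -- for it to shrink, so induction applies to the compressed family with the same shatterer.
    have hsub := shatterer_compress_subset_shatterer a F
    have h1 := card_le_card_shatterer (𝓓 a F)
    rw [Down.card_compression] at h1
    have heq : (𝓓 a F).shatterer = F.shatterer := eq_of_subset_of_card_le hsub (hF.trans h1)
    have hc : #(𝓓 a F).shatterer ≤ #(𝓓 a F) := by rw [heq, Down.card_compression]; exact hF
    rcases ih _ hlt _ hc rfl with h | h
    · rw [heq] at h; rw [h]; exact hlt
    · rw [heq] at h; exact h.trans hlt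

/-- If all sets shattered by `F` lie in `C`, and `F` and `C` have as many members of the same total
size, then `F = C`. -/
theorem eq_of_shatterer_subset {F C : Finset (Finset ι)} (h : F.shatterer ⊆ C) (hcard : #F = #C)
    (hsum : ∑ t ∈ F, #t = ∑ t ∈ C, #t) : F = C := by
  have h1 := card_le_card_shatterer F
  have hC : F.shatterer = C := eq_of_subset_of_card_le h (by omega)
  rcases shatterer_eq_or_sum_card_lt F (by rw [hC, hcard]) with h2 | h2
  · rw [← h2, hC]
  · rw [hC] at h2; omega

/-! ### Rigidity of cubes -/

/-- A graph homomorphism from a cube into the finite subsets of `ι` that is injective and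
sends `∅` to `∅` is induced by an injection of the ground sets. -/
theorem exists_eq_image_of_card_symmDiff {α : Type*} [DecidableEq α] {g : Finset α → Finset ι}
    (hg : Function.Injective g) (h0 : g ∅ = ∅)
    (hadj : ∀ X Y, #(X ∆ Y) = 1 → #(g X ∆ g Y) = 1) :
    ∃ σ : α → ι, Function.Injective σ ∧ ∀ X, g X = X.image σ := by
  have hsing : ∀ a, ∃ i, g {a} = {i} := by
    intro a
    have := hadj {a} ∅ (by rw [← bot_eq_empty, symmDiff_bot, card_singleton])
    rw [h0, ← bot_eq_empty, symmDiff_bot] at this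
    exact card_eq_one.1 this
  choose σ hσ using hsing
  have hσi : Function.Injective σ := by
    intro a b hab
    have : g {a} = g {b} := by rw [hσ, hσ, hab]
    simpa using hg this
  refine ⟨σ, hσi, fun X => ?_⟩
  induction hn : #X using Nat.strong_induction_on generalizing X with
  | _ n ih =>
  subst hn
  rcases X.eq_empty_or_nonempty with rfl | ⟨a, ha⟩
  · simpa using h0
  rcases (X.erase a).eq_empty_or_nonempty with hX | ⟨b, hb⟩
  · have : X = {a} := by rw [← insert_erase ha, hX]; rfl
    rw [this, hσ, image_singleton]
  -- With `M = Y.image σ`, the set `g X` is at distance one from both `insert (σ a) M` and `insert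
  -- (σ b) M`. Only `M` and `M ∪ {σ a, σ b}` are, and `M = g Y` is excluded by injectivity.
  set Y := (X.erase a).erase b with hY
  have hXe : X = insert a (insert b Y) := by rw [hY, insert_erase hb, insert_erase ha]
  have hbY : b ∉ Y := notMem_erase _ _
  have haY : a ∉ Y := fun h => notMem_erase a X (mem_of_mem_erase h)
  have hab : a ≠ b := fun h => by simp [← h] at hb
  have hcX : #X = #Y + 2 := by
    rw [hXe, card_insert_of_notMem (by simp [hab, haY]), card_insert_of_notMem hbY]
  have e1 := ih #Y (by omega) Y rfl
  have e2 := ih #(insert a Y) (by rw [card_insert_of_notMem haY]; omega) _ rfl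
  have e3 := ih #(insert b Y) (by rw [card_insert_of_notMem hbY]; omega) _ rfl
  have a2 := hadj X (insert a Y) (card_eq_one.2 ⟨b, by
    rw [hXe]; ext x; simp only [mem_symmDiff, mem_insert, mem_singleton]; grind⟩)
  have a3 := hadj X (insert b Y) (card_eq_one.2 ⟨a, by
    rw [hXe]; ext x; simp only [mem_symmDiff, mem_insert, mem_singleton]; grind⟩)
  have hne : g X ≠ g Y := fun h => by
    have := hg h
    rw [this] at hcX
    omega
  rw [e2, image_insert] at a2
  rw [e3, image_insert] at a3
  rw [e1] at hne
  rw [hXe, image_insert, image_insert, ← hXe]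
  have ha' : σ a ∉ Y.image σ := by simpa [hσi.eq_iff] using haY
  have hb' : σ b ∉ Y.image σ := by simpa [hσi.eq_iff] using hbY
  have hab' : σ a ≠ σ b := hσi.ne hab
  generalize Y.image σ = M at *
  generalize g X = C at *
  obtain ⟨c, hc⟩ := card_eq_one.1 a2
  obtain ⟨d, hd⟩ := card_eq_one.1 a3
  have hc' : ∀ x, x ∈ C ∆ insert (σ a) M ↔ x = c := fun x => by rw [hc, mem_singleton]
  have hd' : ∀ x, x ∈ C ∆ insert (σ b) M ↔ x = d := fun x => by rw [hd, mem_singleton]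
  simp only [mem_symmDiff, mem_insert] at hc' hd'
  by_cases hca : c = σ a
  · refine absurd (Finset.ext fun x => ?_) hne
    have := hc' x
    subst hca
    by_cases hx : x = σ a
    · subst hx; tauto
    · tauto
  · have hda : d = σ a := by
      have h1 := hc' (σ a)
      have h2 := hd' (σ a)
      tauto
    ext x
    have := hd' x
    simp only [mem_insert]
    subst hda
    by_cases hx : x = σ a
    · subst hx; tauto
    · tauto

/-! ### Counting cubes in a set family -/

variable [Fintype ι]

/-- The pairs `(A, K)` such that `F` contains the `k`-dimensional cube `{A ∪ B | B ⊆ K}`. -/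
def cubePairs (F : Finset (Finset ι)) (k : ℕ) : Finset (Finset ι × Finset ι) :=
  {p | #p.2 = k ∧ Disjoint p.1 p.2 ∧ ∀ X ∈ Icc p.1 (p.1 ∪ p.2), X ∈ F}

theorem mem_cubePairs {F : Finset (Finset ι)} {k : ℕ} {p : Finset ι × Finset ι} :
    p ∈ cubePairs F k ↔
      #p.2 = k ∧ Disjoint p.1 p.2 ∧ ∀ X, p.1 ⊆ X → X ⊆ p.1 ∪ p.2 → X ∈ F := by
  simp [cubePairs]

/-- A cube is determined by its top `A ∪ K`, a member of `F`, and the `k`-subset `K` of that top. -/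
theorem card_cubePairs_le_sum_choose (F : Finset (Finset ι)) (k : ℕ) :
    #(cubePairs F k) ≤ ∑ T ∈ F, (#T).choose k := by
  have hR : #(F.sigma fun T => powersetCard k T) = ∑ T ∈ F, (#T).choose k := by
    simp [card_sigma, card_powersetCard]
  rw [← hR]
  refine card_le_card_of_injOn (fun p => ⟨p.1 ∪ p.2, p.2⟩) ?_ ?_
  · intro p hp
    obtain ⟨hk, -, hF⟩ := mem_cubePairs.1 hp
    simp only [coe_sigma, Set.mem_sigma_iff, mem_coe, mem_powersetCard]
    exact ⟨hF _ subset_union_left subset_rfl, subset_union_right, hk⟩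
  · intro p hp q hq hpq
    have hp' := (mem_cubePairs.1 hp).2.1
    have hq' := (mem_cubePairs.1 hq).2.1
    simp only [Sigma.mk.injEq, heq_eq_eq] at hpq
    have h : p.1 = q.1 := by
      rw [← union_sdiff_cancel_right hp', hpq.1, hpq.2, union_sdiff_cancel_right hq']
    exact Prod.ext h hpq.2

/-- For fixed `K`, Pajor's inequality bounds the number of bottoms by the number of sets `B` they
shatter. The directions in `K` are free above every bottom, so `F` shatters `B ∪ K`; since `B` is
disjoint from `K`, distinct `B` give distinct shattered supersets of `K`. Summing over `K` double
counts the pairs `K ⊆ Q`. -/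
theorem card_cubePairs_le_sum_shatterer (F : Finset (Finset ι)) (k : ℕ) :
    #(cubePairs F k) ≤ ∑ Q ∈ F.shatterer, (#Q).choose k := by
  have hR : ∑ Q ∈ F.shatterer, (#Q).choose k =
      ∑ K ∈ powersetCard k (univ : Finset ι), #{Q ∈ F.shatterer | K ⊆ Q} := by
    simp_rw [← card_powersetCard, card_eq_sum_ones, sum_filter]
    rw [sum_comm]
    refine sum_congr rfl fun Q _ => ?_
    rw [← sum_filter]
    refine sum_congr ?_ fun _ _ => rfl
    ext K
    simp [mem_powersetCard, and_comm]
  rw [hR, card_eq_sum_card_fiberwise (f := Prod.snd) (t := powersetCard k univ)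
    (fun p hp => by simpa using (mem_cubePairs.1 hp).1)]
  refine sum_le_sum fun K hK => ?_
  set FK : Finset (Finset ι) := {p ∈ cubePairs F k | p.2 = K}.image Prod.fst with hFK
  have hmem : ∀ A, A ∈ FK ↔ (A, K) ∈ cubePairs F k := by
    intro A; simp [hFK]
  have h1 : #{p ∈ cubePairs F k | p.2 = K} = #FK := by
    refine (card_image_of_injOn fun p hp q hq hpq => ?_).symm
    simp only [coe_filter, Set.mem_ofPred_eq] at hp hq
    exact Prod.ext hpq (hp.2.trans hq.2.symm)
  rw [h1]
  refine (card_le_card_shatterer FK).trans ?_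
  have hdisj : ∀ B ∈ FK.shatterer, Disjoint B K := by
    intro B hB
    obtain ⟨A, hA, hBA⟩ := (mem_shatterer.1 hB).exists_superset
    exact ((mem_cubePairs.1 ((hmem A).1 hA)).2.1).mono_left hBA
  refine card_le_card_of_injOn (fun B => B ∪ K) ?_ ?_
  · intro B hB
    simp only [coe_filter, Set.mem_ofPred_eq, mem_shatterer]
    refine ⟨fun t ht => ?_, subset_union_right⟩
    obtain ⟨A, hA, hBA⟩ := mem_shatterer.1 hB (inter_subset_left (s₁ := B) (s₂ := t))
    obtain ⟨-, hAK, hF⟩ := mem_cubePairs.1 ((hmem A).1 hA)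
    have hBK := hdisj B hB
    -- `A` already has the right trace on `B` and misses `K`, so exactly `t ∩ K` is added.
    refine ⟨A ∪ (t ∩ K), hF _ subset_union_left
      (union_subset_union_right inter_subset_right), ?_⟩
    ext x
    have h2 := Finset.ext_iff.1 hBA x
    have h3 : x ∈ t → x ∈ B ∪ K := fun h => ht h
    have h4 : x ∈ B → x ∉ K := fun h => disjoint_left.1 hBK h
    have h5 : x ∈ A → x ∉ K := fun h => disjoint_left.1 hAK h
    simp only [mem_union, mem_inter] at *
    tauto
  · intro B hB B' hB' h
    rw [← union_sdiff_cancel_right (hdisj B hB), show B ∪ K = B' ∪ K from h,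
      union_sdiff_cancel_right (hdisj B' hB')]

end Finset

/-! ### Distances and coordinates of partial cubes -/

namespace CubeGraph

section Distance

variable {X ι : Type*} [DecidableEq ι] {Γ : SimpleGraph X} {c : X → Finset ι}

/-- Each edge changes one coordinate, which bounds distances below; `hdesc` always offers a step
that repairs a differing coordinate, which yields a walk of the required length. -/
theorem edist_eq_card_symmDiff (hc : Function.Injective c)
    (hadj : ∀ x y, Γ.Adj x y ↔ #(c x ∆ c y) = 1)
    (hdesc : ∀ x z, x ≠ z → ∃ i ∈ c x ∆ c z, ∃ y, c y = c x ∆ {i}) (x z : X) :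
    Γ.edist x z = #(c x ∆ c z) := by
  apply le_antisymm
  · induction hn : #(c x ∆ c z) generalizing x with
    | zero =>
      have : x = z := hc (by rwa [card_eq_zero, ← bot_eq_empty, symmDiff_eq_bot] at hn)
      simp [this]
    | succ n ih =>
      have hxz : x ≠ z := by
        rintro rfl
        simp at hn
      obtain ⟨i, hi, y, hy⟩ := hdesc x z hxz
      have hxy : Γ.Adj x y := by
        rw [hadj, hy, symmDiff_symmDiff_cancel_left, card_singleton]
      have hyz : #(c y ∆ c z) = n := by
        have := card_symmDiff_singleton_of_mem hi
        rw [hy, symmDiff_right_comm]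
        omega
      calc Γ.edist x z ≤ Γ.edist x y + Γ.edist y z := SimpleGraph.edist_triangle
        _ ≤ 1 + (n : ℕ∞) :=
          add_le_add (SimpleGraph.edist_eq_one_iff_adj.2 hxy).le (ih y hyz)
        _ = ((n + 1 : ℕ) : ℕ∞) := by push_cast; rw [add_comm]
  · have hwalk : ∀ {x z : X} (p : Γ.Walk x z), #(c x ∆ c z) ≤ p.length := by
      intro x z p
      induction p with
      | nil => simp
      | @cons x y z h p ih =>
        have h1 := (hadj x y).1 h
        have h2 := card_symmDiff_triangle (c x) (c y) (c z)
        rw [SimpleGraph.Walk.length_cons]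
        omega
    exact le_iInf fun p => by exact_mod_cast hwalk p

end Distance

theorem hammingDist_eq_card_symmDiff {n : ℕ} (x y : Fin n → Bool) :
    hammingDist x y = #(({i | x i = true} : Finset (Fin n)) ∆ ({i | y i = true} : Finset (Fin n))) := by
  rw [hammingDist]
  congr 1
  ext i
  simp only [mem_filter, mem_univ, true_and, mem_symmDiff]
  cases x i <;> cases y i <;> simp

theorem hypercube_edist {n : ℕ} (x y : Fin n → Bool) :
    (hypercube n).edist x y = hammingDist x y := by
  rw [hammingDist_eq_card_symmDiff]
  refine edist_eq_card_symmDiff (c := fun x : Fin n → Bool => ({i | x i = true} : Finset (Fin n)))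
    ?_ ?_ ?_ x y
  · intro x y h
    funext i
    have := Finset.ext_iff.1 h i
    simp only [mem_filter, mem_univ, true_and] at this
    exact Bool.eq_iff_iff.2 this
  · intro x y
    rw [← hammingDist_eq_card_symmDiff]
    rfl
  · intro x z hxz
    obtain ⟨i, hi⟩ := Function.ne_iff.1 hxz
    refine ⟨i, ?_, fun j => decide (j ∈ ({i | x i = true} : Finset (Fin n)) ∆ {i}), ?_⟩
    · simp only [mem_symmDiff, mem_filter, mem_univ, true_and]
      revert hi
      cases x i <;> cases z i <;> simp
    · ext j
      simp

theorem simplexGraph_edist {ι : Type*} [DecidableEq ι] (H : SimpleGraph ι)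
    (s t : {s : Finset ι // H.IsClique (s : Set ι)}) :
    (simplexGraph H).edist s t = #(s.1 ∆ t.1) := by
  refine edist_eq_card_symmDiff (c := Subtype.val) Subtype.val_injective (fun _ _ => Iff.rfl) ?_ s t
  rintro ⟨s, hs⟩ ⟨t, ht⟩ hne
  -- Elements are added only when `s ⊆ t`, and otherwise removed, so the next set lies inside `t` or
  -- `s` and stays a clique.
  by_cases hst : s ⊆ t
  · have hts : ¬ t ⊆ s := fun h => hne (Subtype.ext (hst.antisymm h))
    obtain ⟨i, hi, his⟩ := not_subset.1 hts
    refine ⟨i, mem_symmDiff.2 (Or.inr ⟨hi, his⟩), ⟨s ∆ {i}, ht.subset ?_⟩, rfl⟩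
    intro j hj
    simp only [mem_coe, mem_symmDiff, mem_singleton] at hj
    rcases hj with hj | hj
    · exact hst hj.1
    · exact hj.1 ▸ hi
  · obtain ⟨i, hi, hit⟩ := not_subset.1 hst
    refine ⟨i, mem_symmDiff.2 (Or.inl ⟨hi, hit⟩), ⟨s ∆ {i}, hs.subset ?_⟩, rfl⟩
    intro j hj
    simp only [mem_coe, mem_symmDiff, mem_singleton] at hj
    rcases hj with hj | hj
    · exact hj.1
    · exact hj.1 ▸ hi

/-- `D` is an isometric embedding of `G` into the cube of subsets of `ι` that sends `u` to `∅` and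
uses every coordinate. -/
structure IsCoordinatization {V ι : Type*} [DecidableEq ι] (G : SimpleGraph V) (u : V)
    (D : V → Finset ι) : Prop where
  edist_eq : ∀ v w, G.edist v w = #(D v ∆ D w)
  base : D u = ∅
  exists_mem : ∀ i, ∃ v, i ∈ D v

theorem IsPartialCube.exists_isCoordinatization {V : Type*} {G : SimpleGraph V}
    (hG : IsPartialCube G) (u : V) :
    ∃ (m : ℕ) (D : V → Finset (Fin m)), IsCoordinatization G u D := by
  classical
  obtain ⟨n, f, hf⟩ := hG
  -- Constant coordinates contribute nothing to distances and are dropped; recording disagreement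
  -- with `f u` moves `u` to `∅`.
  set J := {i : Fin n // ∃ v, f v i ≠ f u i}
  let e : J ≃ Fin (Fintype.card J) := Fintype.equivFin J
  refine ⟨_, fun v => {j | f v (e.symm j) ≠ f u (e.symm j)}, ⟨fun v w => ?_, ?_, fun j => ?_⟩⟩
  · rw [← hf, hypercube_edist, hammingDist, Nat.cast_inj]
    symm
    refine card_bij (fun j _ => (e.symm j).1) ?_ ?_ ?_
    · intro j hj
      simp only [mem_filter, mem_univ, true_and, mem_symmDiff, not_not] at hj ⊢
      grind
    · intro j _ j' _ h
      exact e.symm.injective (Subtype.ext h)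
    · intro i hi
      simp only [mem_filter, mem_univ, true_and] at hi
      have hiJ : ∃ v, f v i ≠ f u i := by
        by_contra! h
        exact hi ((h v).trans (h w).symm)
      refine ⟨e ⟨i, hiJ⟩, ?_, by simp⟩
      simp only [mem_filter, mem_univ, true_and, mem_symmDiff, not_not, Equiv.symm_apply_apply]
      revert hi
      cases f v i <;> cases f w i <;> cases f u i <;> simp
  · simp
  · obtain ⟨v, hv⟩ := (e.symm j).2
    exact ⟨v, by simpa using hv⟩

/-- The crossing graph of the coordinates of `D`, in coordinates based at a vertex sent to `∅`. -/
def coordinateCrossing {V ι : Type*} (D : V → Finset ι) : SimpleGraph ι where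
  Adj i j := i ≠ j ∧ (∃ v, i ∈ D v ∧ j ∈ D v) ∧ (∃ v, i ∈ D v ∧ j ∉ D v) ∧ ∃ v, i ∉ D v ∧ j ∈ D v
  symm := ⟨fun _ _ ⟨hne, ⟨v, hv⟩, ⟨w, hw⟩, ⟨x, hx⟩⟩ =>
    ⟨hne.symm, ⟨v, hv.symm⟩, ⟨x, hx.symm⟩, ⟨w, hw.symm⟩⟩⟩
  loopless := ⟨fun _ h => h.1 rfl⟩

/-! ### Θ-classes and crossings in coordinates -/

namespace IsCoordinatization

variable {V ι : Type*} [DecidableEq ι] {G : SimpleGraph V} {u : V} {D : V → Finset ι}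

theorem dist_eq (hD : IsCoordinatization G u D) (v w : V) : G.dist v w = #(D v ∆ D w) := by
  rw [SimpleGraph.dist, hD.edist_eq, ENat.toNat_natCast]

theorem edist_base (hD : IsCoordinatization G u D) (v : V) : G.edist u v = #(D v) := by
  rw [hD.edist_eq, hD.base, ← bot_eq_empty, bot_symmDiff]

theorem injective (hD : IsCoordinatization G u D) : Function.Injective D := by
  intro v w h
  have := hD.edist_eq v w
  rw [h] at this
  simpa using this

theorem adj_iff (hD : IsCoordinatization G u D) {v w : V} : G.Adj v w ↔ #(D v ∆ D w) = 1 := by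
  rw [← SimpleGraph.edist_eq_one_iff_adj, hD.edist_eq]
  norm_cast

theorem adj_of_eq (hD : IsCoordinatization G u D) {v w : V} {i : ι} (h : D w = D v ∆ {i}) :
    G.Adj v w := by
  rw [hD.adj_iff, h, symmDiff_symmDiff_cancel_left, card_singleton]

theorem exists_eq_of_adj (hD : IsCoordinatization G u D) {v w : V} (h : G.Adj v w) :
    ∃ i, D w = D v ∆ {i} := by
  obtain ⟨i, hi⟩ := card_eq_one.1 (hD.adj_iff.1 h)
  exact ⟨i, by rw [← hi, symmDiff_symmDiff_cancel_left]⟩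

/-- A walk from `u` to a vertex whose set contains `i` must somewhere enter the side containing `i`,
and that edge changes only one coordinate. -/
theorem exists_edge (hD : IsCoordinatization G u D) (i : ι) : ∃ a b, D b = D a ∆ {i} := by
  obtain ⟨v, hv⟩ := hD.exists_mem i
  have hr : G.Reachable u v := by
    rw [← SimpleGraph.edist_ne_top_iff_reachable, hD.edist_eq]
    exact ENat.natCast_ne_top _
  obtain ⟨p⟩ := hr
  obtain ⟨d, -, hd1, hd2⟩ := p.exists_boundary_dart {w | i ∉ D w} (by simp [hD.base]) (by simpa)
  obtain ⟨j, hj⟩ := hD.exists_eq_of_adj d.adj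
  have hij : i = j := by
    simp only [Set.mem_ofPred_eq, not_not] at hd1 hd2
    simp only [hj, mem_symmDiff, mem_singleton, hd1, false_and, not_false_eq_true, and_true,
      false_or] at hd2
    exact hd2
  exact ⟨d.fst, d.snd, hij ▸ hj⟩

/-- The distances from `w` to `a` and `b` differ by exactly one, with the sign decided by coordinate
`i` alone. -/
theorem mem_halfspace_iff (hD : IsCoordinatization G u D) {a b : V} {i : ι}
    (h : D b = D a ∆ {i}) (w : V) : w ∈ halfspace G a b ↔ (i ∈ D w ↔ i ∈ D a) := by
  have h1 : D b ∆ D w = D a ∆ D w ∆ {i} := by rw [h, symmDiff_right_comm]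
  have hmem : i ∈ D a ∆ D w ↔ ¬ (i ∈ D w ↔ i ∈ D a) := by
    rw [mem_symmDiff]; tauto
  rw [halfspace, Set.mem_ofPred_eq, hD.dist_eq, hD.dist_eq, h1]
  by_cases hi : i ∈ D a ∆ D w
  · have := card_symmDiff_singleton_of_mem hi
    have := hmem.1 hi
    simp only [this, iff_false]
    omega
  · have := card_symmDiff_singleton_of_notMem hi
    have := not_not.1 (mt hmem.2 hi)
    simp only [this, iff_true]
    omega

theorem symmDiff_singleton_comm {a b : V} {i : ι} (h : D b = D a ∆ {i}) : D a = D b ∆ {i} := by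
  rw [h, symmDiff_assoc, symmDiff_self, symmDiff_bot]

/-- The edges along which the coordinate `i` changes. -/
def edgesAlong (D : V → Finset ι) (i : ι) : Set (Sym2 V) :=
  {e | ∃ x y, e = s(x, y) ∧ D y = D x ∆ {i}}

theorem edgesAlong_injective (hD : IsCoordinatization G u D) :
    Function.Injective (edgesAlong D) := by
  intro i j h
  obtain ⟨a, b, hab⟩ := hD.exists_edge i
  have : s(a, b) ∈ edgesAlong D j := h ▸ ⟨a, b, rfl, hab⟩
  obtain ⟨x, y, hxy, hj⟩ := this
  have hba := symmDiff_singleton_comm hab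
  rw [Sym2.eq_iff] at hxy
  rcases hxy with ⟨rfl, rfl⟩ | ⟨rfl, rfl⟩
  · exact singleton_injective (symmDiff_right_injective _ (hab.symm.trans hj))
  · exact singleton_injective (symmDiff_right_injective _ (hba.symm.trans hj))

/-- Written with `A = D p ∆ D x`, the Θ inequality is that of `card_add_card_symmDiff_ne_iff`:
related edges are those that change the same coordinate. -/
theorem thetaClass_eq (hD : IsCoordinatization G u D) {a b : V} {i : ι} (h : D b = D a ∆ {i}) :
    thetaClass G a b = edgesAlong D i := by
  have key : ∀ {p q x y : V} {j : ι}, D q = D p ∆ {j} → D y = D x ∆ {i} →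
      (G.dist p x + G.dist q y ≠ G.dist p y + G.dist q x ↔ j = i) := by
    intro p q x y j hq hy
    rw [← card_add_card_symmDiff_ne_iff (D p ∆ D x) i j]
    simp only [hD.dist_eq, hq, hy]
    have e1 : D p ∆ {j} ∆ (D x ∆ {i}) = D p ∆ D x ∆ {j} ∆ {i} := by
      rw [← symmDiff_assoc, symmDiff_right_comm (D p) {j}]
    rw [e1, symmDiff_right_comm (D p) {j}, ← symmDiff_assoc]
  ext e
  constructor
  · rintro ⟨p, q, x, y, rfl, hab, hpq, hxy, hne⟩
    have hy : D y = D x ∆ {i} := by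
      rw [Sym2.eq_iff] at hab
      rcases hab with ⟨rfl, rfl⟩ | ⟨rfl, rfl⟩
      · exact h
      · exact symmDiff_singleton_comm h
    obtain ⟨j, hj⟩ := hD.exists_eq_of_adj hpq
    exact ⟨p, q, rfl, ((key hj hy).1 hne) ▸ hj⟩
  · rintro ⟨p, q, rfl, hq⟩
    exact ⟨p, q, a, b, rfl, rfl, hD.adj_of_eq hq, hD.adj_of_eq h, (key hq h).2 rfl⟩

theorem exists_thetaClass (hD : IsCoordinatization G u D) (i : ι) :
    ∃ a b, G.Adj a b ∧ edgesAlong D i = thetaClass G a b := by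
  obtain ⟨a, b, hab⟩ := hD.exists_edge i
  exact ⟨a, b, hD.adj_of_eq hab, (hD.thetaClass_eq hab).symm⟩

theorem cross_iff (hD : IsCoordinatization G u D) {i j : ι} {F F' : ThetaClasses G}
    (hF : F.1 = edgesAlong D i) (hF' : F'.1 = edgesAlong D j) :
    Cross G F F' ↔
      (∃ v, i ∈ D v ∧ j ∈ D v) ∧ (∃ v, i ∈ D v ∧ j ∉ D v) ∧ ∃ v, i ∉ D v ∧ j ∈ D v := by
  -- The fourth quadrant always contains the base vertex. Reversing an edge only permutes the
  -- quadrants, so orientations do not matter below.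
  have h00 : ∃ v, i ∉ D v ∧ j ∉ D v := ⟨u, by simp [hD.base]⟩
  have key : ∀ {a b p q : V}, D b = D a ∆ {i} → D q = D p ∆ {j} →
      (((halfspace G a b ∩ halfspace G p q).Nonempty ∧
      (halfspace G b a ∩ halfspace G p q).Nonempty ∧
      (halfspace G a b ∩ halfspace G q p).Nonempty ∧
      (halfspace G b a ∩ halfspace G q p).Nonempty) ↔
      (∃ v, i ∈ D v ∧ j ∈ D v) ∧ (∃ v, i ∈ D v ∧ j ∉ D v) ∧ ∃ v, i ∉ D v ∧ j ∈ D v) := by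
    intro a b p q hb hq
    have hib : i ∈ D b ↔ i ∉ D a := by rw [hb]; simp [mem_symmDiff]
    have hjq : j ∈ D q ↔ j ∉ D p := by rw [hq]; simp [mem_symmDiff]
    simp only [Set.Nonempty, Set.mem_inter_iff, hD.mem_halfspace_iff hb,
      hD.mem_halfspace_iff hq, hD.mem_halfspace_iff (symmDiff_singleton_comm hb),
      hD.mem_halfspace_iff (symmDiff_singleton_comm hq), hib, hjq]
    by_cases hi : i ∈ D a <;> by_cases hj : j ∈ D p <;>
      simp only [hi, hj, iff_true, iff_false, not_true, not_false_eq_true] <;> tauto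
  constructor
  · rintro ⟨a, b, p, q, hab, hpq, ha, hp, hx⟩
    obtain ⟨i', hi'⟩ := hD.exists_eq_of_adj hab
    obtain ⟨j', hj'⟩ := hD.exists_eq_of_adj hpq
    rw [hF, hD.thetaClass_eq hi'] at ha
    rw [hF', hD.thetaClass_eq hj'] at hp
    obtain rfl := hD.edgesAlong_injective ha
    obtain rfl := hD.edgesAlong_injective hp
    exact (key hi' hj').1 hx
  · intro hx
    obtain ⟨a, b, hab⟩ := hD.exists_edge i
    obtain ⟨p, q, hpq⟩ := hD.exists_edge j
    exact ⟨a, b, p, q, hD.adj_of_eq hab, hD.adj_of_eq hpq, by rw [hF, hD.thetaClass_eq hab],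
      by rw [hF', hD.thetaClass_eq hpq], (key hab hpq).2 hx⟩

/-- The crossing graph of `G` is the crossing graph of the coordinates. -/
theorem nonempty_crossingGraph_iso (hD : IsCoordinatization G u D) :
    Nonempty (coordinateCrossing D ≃g crossingGraph G) := by
  let φ : ι → ThetaClasses G := fun i => ⟨edgesAlong D i, hD.exists_thetaClass i⟩
  have hφ : Function.Bijective φ := by
    refine ⟨fun i j h => hD.edgesAlong_injective (congrArg Subtype.val h), ?_⟩
    rintro ⟨F, a, b, hab, rfl⟩
    obtain ⟨i, hi⟩ := hD.exists_eq_of_adj hab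
    exact ⟨i, Subtype.ext (hD.thetaClass_eq hi).symm⟩
  refine ⟨⟨Equiv.ofBijective φ hφ, ?_⟩⟩
  intro i j
  change (φ i ≠ φ j ∧ Cross G (φ i) (φ j)) ↔ _
  rw [hD.cross_iff (i := i) (j := j) rfl rfl, hφ.1.ne_iff]
  rfl

end IsCoordinatization

end CubeGraph

/-! ### Polynomials as sums over set families -/

namespace CubeGraph

theorem sum_monomial_card_fiber {α : Type*} (s : Finset α) (g : α → ℕ) {N : ℕ}
    (h : ∀ a ∈ s, g a < N) :
    ∑ i ∈ range N, monomial i #{a ∈ s | g a = i} = ∑ a ∈ s, (X : ℕ[X]) ^ g a := by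
  rw [← sum_fiberwise_of_maps_to (t := range N) (g := g) (fun a ha => mem_range.2 (h a ha))]
  refine sum_congr rfl fun i _ => ?_
  rw [sum_congr rfl fun a ha => by rw [(mem_filter.1 ha).2], sum_const, ← monomial_one_right_eq_X_pow,
    smul_monomial]
  simp

theorem coeff_sum_X_pow_comp {α : Type*} (s : Finset α) (g : α → ℕ) (k : ℕ) :
    ((∑ a ∈ s, (X : ℕ[X]) ^ g a).comp (X + 1)).coeff k = ∑ a ∈ s, (g a).choose k := by
  rw [Polynomial.sum_comp, finsetSum_coeff]
  refine sum_congr rfl fun a _ => ?_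
  rw [X_pow_comp, coeff_X_add_one_pow, Nat.cast_id]

/-- Over `ℤ` the substitution is the Taylor shift at `1`, which is injective. -/
theorem comp_X_add_one_injective : Function.Injective fun p : ℕ[X] => p.comp (X + 1) := by
  intro p q h
  apply Polynomial.map_injective (Nat.castRingHom ℤ) Nat.cast_injective
  apply taylor_injective (1 : ℤ)
  have := congrArg (Polynomial.map (Nat.castRingHom ℤ)) h
  simpa [taylor_apply, Polynomial.map_comp] using this

/-- The cliques of a finite graph. -/
noncomputable def cliqueFamily {α : Type*} [Fintype α] (H : SimpleGraph α) : Finset (Finset α) :=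
  open scoped Classical in {s | H.IsClique (s : Set α)}

theorem mem_cliqueFamily {α : Type*} [Fintype α] {H : SimpleGraph α} {s : Finset α} :
    s ∈ cliqueFamily H ↔ H.IsClique (s : Set α) := by
  simp [cliqueFamily]

theorem cliquePolynomial_eq_sum {α : Type*} [Fintype α] (H : SimpleGraph α) :
    cliquePolynomial H = ∑ s ∈ cliqueFamily H, X ^ #s := by
  rw [← sum_monomial_card_fiber (cliqueFamily H) card (N := Nat.card α + 1)
    (fun s _ => by rw [Nat.card_eq_fintype_card]; exact Nat.lt_succ_of_le (card_le_univ s)),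
    cliquePolynomial]
  refine sum_congr rfl fun i _ => ?_
  congr 1
  rw [cliqueCount, ← Set.ncard_coe_finset]
  congr 1
  ext s
  simp [SimpleGraph.isNClique_iff, mem_cliqueFamily]

theorem cliqueCount_congr {α β : Type*} {H : SimpleGraph α} {H' : SimpleGraph β} (e : H ≃g H')
    (i : ℕ) : cliqueCount H i = cliqueCount H' i := by
  rw [cliqueCount, cliqueCount, ← Set.ncard_image_of_injective _ (map_injective e.toEquiv.toEmbedding)]
  congr 1
  ext t
  simp only [Set.mem_image, Set.mem_ofPred_eq]
  constructor
  · rintro ⟨s, hs, rfl⟩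
    rw [SimpleGraph.isNClique_iff] at hs ⊢
    refine ⟨?_, by rw [card_map, hs.2]⟩
    rintro _ hx _ hy hne
    simp only [coe_map, Set.mem_image, mem_coe] at hx hy
    obtain ⟨x, hx, rfl⟩ := hx
    obtain ⟨y, hy, rfl⟩ := hy
    exact e.map_rel_iff.2 (hs.1 hx hy fun h => hne (by rw [h]))
  · intro ht
    rw [SimpleGraph.isNClique_iff] at ht
    refine ⟨t.map e.symm.toEquiv.toEmbedding, ?_, ?_⟩
    swap
    · ext x
      simp only [mem_map_equiv]
      change e (e.symm x) ∈ t ↔ x ∈ t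
      rw [e.apply_symm_apply]
    rw [SimpleGraph.isNClique_iff]
    refine ⟨?_, by rw [card_map, ht.2]⟩
    rintro _ hx _ hy hne
    simp only [coe_map, Set.mem_image, mem_coe] at hx hy
    obtain ⟨x, hx, rfl⟩ := hx
    obtain ⟨y, hy, rfl⟩ := hy
    exact e.symm.map_rel_iff.2 (ht.1 hx hy fun h => hne (by rw [h]))

theorem cliquePolynomial_congr {α β : Type*} {H : SimpleGraph α} {H' : SimpleGraph β}
    (e : H ≃g H') : cliquePolynomial H = cliquePolynomial H' := by
  simp only [cliquePolynomial, cliqueCount_congr e, Nat.card_congr e.toEquiv]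

theorem coeff_cubePolynomial_le {V : Type*} (G : SimpleGraph V) (k : ℕ) :
    (cubePolynomial G).coeff k ≤ cubeCount G k := by
  rw [cubePolynomial, finsetSum_coeff]
  simp only [coeff_monomial]
  rw [sum_ite_eq']
  split_ifs <;> simp

/-! ### Induced cubes, the two bounds and the equality case -/

namespace IsCoordinatization

variable {V ι : Type*} [DecidableEq ι] {G : SimpleGraph V} {u : V} {D : V → Finset ι}

/-- Induced cubes are intervals of the poset of subsets of `ι`. -/
theorem exists_interval_of_iso (hD : IsCoordinatization G u D) {S : Set V} {k : ℕ}
    (hS : Nonempty (G.induce S ≃g hypercube k)) :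
    ∃ A K : Finset ι, #K = k ∧ Disjoint A K ∧ ∀ X, X ∈ D '' S ↔ A ⊆ X ∧ X ⊆ A ∪ K := by
  obtain ⟨e⟩ := hS
  let χ : Finset (Fin k) → Fin k → Bool := fun X i => decide (i ∈ X)
  have hχ : Function.Injective χ := by
    intro X Y h
    ext i
    simpa [χ] using congrFun h i
  have hχs : Function.Surjective χ := fun f => ⟨({i | f i = true} : Finset (Fin k)), by funext i; simp [χ]⟩
  let g : Finset (Fin k) → Finset ι := fun X => D (e.symm (χ X)).1
  have hg : Function.Injective g := fun X Y h =>
    hχ (e.symm.injective (Subtype.ext (hD.injective h)))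
  have hgS : ∀ Y, Y ∈ D '' S ↔ ∃ X, g X = Y := by
    intro Y
    constructor
    · rintro ⟨v, hv, rfl⟩
      obtain ⟨X, hX⟩ := hχs (e ⟨v, hv⟩)
      exact ⟨X, by simp [g, hX]⟩
    · rintro ⟨X, rfl⟩
      exact ⟨_, (e.symm (χ X)).2, rfl⟩
  have hadj : ∀ X Y : Finset (Fin k), #(X ∆ Y) = 1 → #(g X ∆ g Y) = 1 := by
    intro X Y h
    have h1 : (hypercube k).Adj (χ X) (χ Y) := by
      change hammingDist (χ X) (χ Y) = 1
      rw [hammingDist_eq_card_symmDiff]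
      simpa [χ] using h
    exact hD.adj_iff.1 (e.symm.map_rel_iff.2 h1)
  -- Translation by `g ∅` sends the base of the cube to `∅`, as the rigidity lemma requires.
  obtain ⟨σ, hσ, hσX⟩ := exists_eq_image_of_card_symmDiff (g := fun X => g ∅ ∆ g X)
    (fun X Y h => hg (symmDiff_right_injective _ h)) (by simp)
    (fun X Y h => by
      rw [symmDiff_symmDiff_symmDiff_comm, symmDiff_self, bot_symmDiff]
      exact hadj X Y h)
  have hgX : ∀ X, g X = g ∅ ∆ X.image σ := fun X => by
    rw [← hσX, symmDiff_symmDiff_cancel_left]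
  set P := g ∅
  set K := (univ : Finset (Fin k)).image σ with hK
  -- `P` may be any vertex of the cube; clearing all its directions `K` gives the bottom.
  refine ⟨P \ K, K, by rw [hK, card_image_of_injective _ hσ, card_univ, Fintype.card_fin],
    sdiff_disjoint, fun Y => ?_⟩
  rw [hgS]
  constructor
  · rintro ⟨X, rfl⟩
    have hXK : X.image σ ⊆ K := image_subset_image (subset_univ X)
    rw [hgX]
    constructor <;> intro x <;> have := @hXK x <;>
      simp only [mem_union, mem_sdiff, mem_symmDiff] <;> tauto
  · rintro ⟨h1, h2⟩
    have hsub : P ∆ Y ⊆ univ.image σ := by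
      intro x hx
      have h1 := @h1 x
      have h2 := @h2 x
      simp only [mem_union, mem_sdiff, mem_symmDiff] at *
      tauto
    obtain ⟨X, -, hX⟩ := subset_image_iff.1 hsub
    exact ⟨X, by rw [hgX, hX, symmDiff_symmDiff_cancel_left]⟩

theorem distancePolynomial_eq_sum [Fintype V] (hD : IsCoordinatization G u D) :
    distancePolynomial G u = ∑ A ∈ univ.image D, X ^ #A := by
  rw [sum_image fun _ _ _ _ h => hD.injective h, ← sum_monomial_card_fiber univ (fun v => #(D v))
    (N := Nat.card V) ?_, distancePolynomial]
  · refine sum_congr rfl fun d _ => ?_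
    congr 1
    rw [distanceCount, ← Set.ncard_coe_finset]
    congr 1
    ext v
    simp [hD.edist_base]
  -- A shortest path repeats no vertex, so the truncation at `Nat.card V` loses nothing.
  · intro v _
    have hr : G.Reachable u v := by
      rw [← SimpleGraph.edist_ne_top_iff_reachable, hD.edist_eq]
      exact ENat.natCast_ne_top _
    obtain ⟨p, hp, hlen⟩ := hr.exists_path_of_dist
    have h1 := hp.length_lt
    have h2 : G.dist u v = #(D v) := by rw [SimpleGraph.dist, hD.edist_base, ENat.toNat_natCast]
    rw [Nat.card_eq_fintype_card]
    omega

theorem cliquePolynomial_crossingGraph [Fintype ι] (hD : IsCoordinatization G u D) :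
    cliquePolynomial (crossingGraph G) =
      ∑ s ∈ cliqueFamily (coordinateCrossing D), X ^ #s := by
  obtain ⟨e⟩ := hD.nonempty_crossingGraph_iso
  rw [← cliquePolynomial_congr e, cliquePolynomial_eq_sum]

variable [Fintype V] [Fintype ι]

theorem cubeCount_le_card_cubePairs (hD : IsCoordinatization G u D) (k : ℕ) :
    cubeCount G k ≤ #((univ.image D).cubePairs k) := by
  have h := fun S : {S : Set V // Nonempty (G.induce S ≃g hypercube k)} =>
    hD.exists_interval_of_iso S.2
  choose A K hK hAK hS using h
  rw [cubeCount, ← Nat.card_coe_set_eq, ← Fintype.card_coe, ← Nat.card_eq_fintype_card]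
  refine Nat.card_le_card_of_injective
    (fun S => ⟨(A S, K S), mem_cubePairs.2 ⟨hK S, hAK S, fun X h1 h2 => ?_⟩⟩) ?_
  · obtain ⟨v, -, hv⟩ := (hS S X).2 ⟨h1, h2⟩
    exact mem_image.2 ⟨v, mem_univ v, hv⟩
  · intro S T hST
    simp only [Subtype.mk.injEq, Prod.mk.injEq] at hST
    apply Subtype.ext
    apply hD.injective.image_injective
    ext X
    rw [hS S, hS T, hST.1, hST.2]

/-- For distinct `i, j` in a shattered `s`, the traces `s`, `{i}` and `{j}` supply the three
required vertices. -/
theorem shatterer_subset_cliqueFamily :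
    (univ.image D).shatterer ⊆ cliqueFamily (coordinateCrossing D) := by
  intro s hs
  rw [mem_shatterer] at hs
  rw [mem_cliqueFamily]
  have key : ∀ t ⊆ s, ∃ v, ∀ i ∈ s, (i ∈ D v ↔ i ∈ t) := by
    intro t ht
    obtain ⟨_, hr, hst⟩ := hs ht
    obtain ⟨v, -, rfl⟩ := mem_image.1 hr
    exact ⟨v, fun i hi => by rw [← hst, mem_inter]; tauto⟩
  intro i hi j hj hij
  rw [mem_coe] at hi hj
  obtain ⟨v, hv⟩ := key s subset_rfl
  obtain ⟨w, hw⟩ := key {i} (singleton_subset_iff.2 hi)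
  obtain ⟨x, hx⟩ := key {j} (singleton_subset_iff.2 hj)
  exact ⟨hij, ⟨v, (hv i hi).2 hi, (hv j hj).2 hj⟩,
    ⟨w, (hw i hi).2 (mem_singleton_self i), fun h => hij (mem_singleton.1 ((hw j hj).1 h)).symm⟩,
    ⟨x, fun h => hij (mem_singleton.1 ((hx i hi).1 h)), (hx j hj).2 (mem_singleton_self j)⟩⟩

theorem cubeCount_le_distance (hD : IsCoordinatization G u D) (k : ℕ) :
    cubeCount G k ≤ ((distancePolynomial G u).comp (X + 1)).coeff k := by
  rw [hD.distancePolynomial_eq_sum, coeff_sum_X_pow_comp]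
  exact (hD.cubeCount_le_card_cubePairs k).trans (card_cubePairs_le_sum_choose _ k)

theorem cubeCount_le_clique (hD : IsCoordinatization G u D) (k : ℕ) :
    cubeCount G k ≤ ((cliquePolynomial (crossingGraph G)).comp (X + 1)).coeff k := by
  rw [hD.cliquePolynomial_crossingGraph, coeff_sum_X_pow_comp]
  exact (hD.cubeCount_le_card_cubePairs k).trans
    ((card_cubePairs_le_sum_shatterer _ k).trans
      (sum_le_sum_of_subset shatterer_subset_cliqueFamily))

/-- Only the values at `1` (cardinality) and the derivatives at `1` (total size) are used. -/
theorem image_eq_cliqueFamily (hD : IsCoordinatization G u D)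
    (h : distancePolynomial G u = cliquePolynomial (crossingGraph G)) :
    univ.image D = cliqueFamily (coordinateCrossing D) := by
  rw [hD.distancePolynomial_eq_sum, hD.cliquePolynomial_crossingGraph] at h
  refine eq_of_shatterer_subset shatterer_subset_cliqueFamily ?_ ?_
  · simpa [eval_finsetSum] using congrArg (eval 1) h
  · simpa [derivative_sum, derivative_X_pow, eval_finsetSum] using
      congrArg (fun p => eval 1 (derivative p)) h

/-- A graph whose coordinates are the cliques of a graph is the simplex graph of that graph. -/
theorem isSimplexGraphAt {m : ℕ} {D : V → Finset (Fin m)} (hD : IsCoordinatization G u D)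
    {H : SimpleGraph (Fin m)} (h : univ.image D = cliqueFamily H) : IsSimplexGraphAt G u := by
  have hcl : ∀ v, H.IsClique (D v : Set (Fin m)) := fun v => by
    rw [← mem_cliqueFamily, ← h]
    exact mem_image_of_mem _ (mem_univ v)
  let ψ : V → {s : Finset (Fin m) // H.IsClique (s : Set (Fin m))} := fun v => ⟨D v, hcl v⟩
  have hψ : Function.Bijective ψ := by
    refine ⟨fun v w hvw => hD.injective (congrArg Subtype.val hvw), ?_⟩
    rintro ⟨s, hs⟩
    rw [← mem_cliqueFamily, ← h] at hs
    obtain ⟨v, -, rfl⟩ := mem_image.1 hs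
    exact ⟨v, rfl⟩
  refine ⟨m, H, ⟨Equiv.ofBijective ψ hψ, ?_⟩, hD.base⟩
  intro v w
  exact hD.adj_iff.symm

end IsCoordinatization

/-! ### Simplex graphs and the main theorem -/

theorem edist_map_iso {V W : Type*} {G : SimpleGraph V} {G' : SimpleGraph W} (φ : G ≃g G')
    (v w : V) : G'.edist (φ v) (φ w) = G.edist v w := by
  apply le_antisymm
  · refine le_iInf fun p => ?_
    simpa using SimpleGraph.edist_le (p.map φ.toHom)
  · refine le_iInf fun p => ?_
    simpa using SimpleGraph.edist_le (p.map φ.symm.toHom)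

theorem isCoordinatization_of_iso_simplexGraph {V : Type*} {G : SimpleGraph V} {u : V} {n : ℕ}
    {H : SimpleGraph (Fin n)} (φ : G ≃g simplexGraph H) (hu : (φ u).1 = ∅) :
    IsCoordinatization G u fun v => (φ v).1 where
  edist_eq v w := by rw [← simplexGraph_edist, edist_map_iso]
  base := hu
  exists_mem i := ⟨φ.symm ⟨{i}, by simp⟩, by simp⟩

/-- A clique containing both `i` and `j` forces an edge; conversely an edge gives the cliques `{i,
j}`, `{i}`, `{j}` as witnesses. -/
theorem coordinateCrossing_of_iso_simplexGraph {V : Type*} {G : SimpleGraph V} {n : ℕ}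
    {H : SimpleGraph (Fin n)} (φ : G ≃g simplexGraph H) :
    coordinateCrossing (fun v => (φ v).1) = H := by
  ext i j
  constructor
  · rintro ⟨hij, ⟨v, hi, hj⟩, -⟩
    exact (φ v).2 hi hj hij
  · intro hij
    refine ⟨hij.ne, ⟨φ.symm ⟨{i, j}, ?_⟩, by simp⟩, ⟨φ.symm ⟨{i}, by simp⟩, ?_⟩,
      ⟨φ.symm ⟨{j}, by simp⟩, ?_⟩⟩
    · rw [coe_pair, SimpleGraph.isClique_pair]
      exact fun _ => hij
    · simp [hij.ne']
    · simp [hij.ne]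

theorem IsSimplexGraphAt.distancePolynomial_eq {V : Type*} [Finite V] {G : SimpleGraph V} {u : V}
    (h : IsSimplexGraphAt G u) :
    distancePolynomial G u = cliquePolynomial (crossingGraph G) := by
  obtain ⟨n, H, φ, hu⟩ := h
  have := Fintype.ofFinite V
  have hD := isCoordinatization_of_iso_simplexGraph φ hu
  rw [hD.distancePolynomial_eq_sum, hD.cliquePolynomial_crossingGraph,
    coordinateCrossing_of_iso_simplexGraph]
  refine sum_congr ?_ fun _ _ => rfl
  ext s
  rw [mem_cliqueFamily, mem_image]
  constructor
  · rintro ⟨v, -, rfl⟩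
    exact (φ v).2
  · intro hs
    exact ⟨φ.symm ⟨s, hs⟩, mem_univ _, by simp⟩

theorem IsPartialCube.isSimplexGraphAt_iff {V : Type*} [Finite V] {G : SimpleGraph V}
    (hG : IsPartialCube G) (u : V) : IsSimplexGraphAt G u ↔
      distancePolynomial G u = cliquePolynomial (crossingGraph G) := by
  refine ⟨IsSimplexGraphAt.distancePolynomial_eq, fun h => ?_⟩
  have := Fintype.ofFinite V
  obtain ⟨m, D, hD⟩ := hG.exists_isCoordinatization u
  exact hD.isSimplexGraphAt (hD.image_eq_cliqueFamily h)

theorem isSimplexGraph_iff_exists {V : Type*} {G : SimpleGraph V} :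
    IsSimplexGraph G ↔ ∃ u, IsSimplexGraphAt G u := by
  constructor
  · rintro ⟨n, H, ⟨φ⟩⟩
    exact ⟨φ.symm ⟨∅, by simp⟩, n, H, φ, by simp⟩
  · rintro ⟨u, n, H, φ, -⟩
    exact ⟨n, H, ⟨φ⟩⟩

end CubeGraph

theorem theorem4 {V : Type*} [Finite V] (G : SimpleGraph V) (hG : CubeGraph.IsPartialCube G) :
    (∀ u : V, CubeGraph.IsSimplexGraphAt G u ↔
      CubeGraph.distancePolynomial G u =
        CubeGraph.cliquePolynomial (CubeGraph.crossingGraph G)) ∧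
    (∀ (u : V) (k : ℕ), (CubeGraph.cubePolynomial G).coeff k ≤
      ((CubeGraph.distancePolynomial G u).comp (Polynomial.X + 1)).coeff k) ∧
    (∀ k : ℕ, (CubeGraph.cubePolynomial G).coeff k ≤
      ((CubeGraph.cliquePolynomial (CubeGraph.crossingGraph G)).comp
        (Polynomial.X + 1)).coeff k) ∧
    (∀ u : V, (CubeGraph.distancePolynomial G u).comp (Polynomial.X + 1) =
        (CubeGraph.cliquePolynomial (CubeGraph.crossingGraph G)).comp (Polynomial.X + 1) ↔
      CubeGraph.IsSimplexGraphAt G u) ∧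
    (CubeGraph.IsSimplexGraph G ↔
      ∃ u : V, (CubeGraph.distancePolynomial G u).comp (Polynomial.X + 1) =
        (CubeGraph.cliquePolynomial (CubeGraph.crossingGraph G)).comp (Polynomial.X + 1)) := by
  have := Fintype.ofFinite V
  have hcomp : ∀ u : V, (CubeGraph.distancePolynomial G u).comp (X + 1) =
      (CubeGraph.cliquePolynomial (CubeGraph.crossingGraph G)).comp (X + 1) ↔
      CubeGraph.IsSimplexGraphAt G u := fun u => by
    rw [hG.isSimplexGraphAt_iff]
    exact CubeGraph.comp_X_add_one_injective.eq_iff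
  refine ⟨hG.isSimplexGraphAt_iff, fun u k => ?_, fun k => ?_, hcomp, ?_⟩
  · obtain ⟨m, D, hD⟩ := hG.exists_isCoordinatization u
    exact (CubeGraph.coeff_cubePolynomial_le G k).trans (hD.cubeCount_le_distance k)
  · cases isEmpty_or_nonempty V with
    -- Without vertices there is no base point, but the cube polynomial is an empty sum.
    | inl h => simp [CubeGraph.cubePolynomial]
    | inr h =>
      obtain ⟨u⟩ := h
      obtain ⟨m, D, hD⟩ := hG.exists_isCoordinatization u
      exact (CubeGraph.coeff_cubePolynomial_le G k).trans (hD.cubeCount_le_clique k)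
  · rw [CubeGraph.isSimplexGraph_iff_exists]
    exact exists_congr fun u => (hcomp u).symm
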